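/- Let $n\ge 1$. Let $\mathcal B(n)$ be the set of all compact convex bodies of $\mathbb R^n$ (compact convex sets with nonempty interior) that are symmetric about the origin, equipped with the Hausdorff metric of the Euclidean distance and with the continuous action $gA=\{ga : a\in A\}$ of the group $GL(n)$ of invertible real $n\times n$ matrices. Let $O(n)\subset GL(n)$ be the orthogonal group, and let $J(n)\subset\mathcal B(n)$ be the set of all $A\in\mathcal B(n)$ for which the closed Euclidean unit ball is the ellipsoid of maximal volume contained in $A$ (ellipsoids may have any centre). For a $G$-space $X$ and a closed subgroup $H\subset G$, a subset $S\subset X$ is a global $H$-slice if $HS=S$, $S$ is closed in $X$, $gS\cap S=\emptyset$ for every $g\in G\setminus H$, and $GS=X$. Its slicing map is the well-defined map $f_S:X\to G/H$ given by $f_S(gs)=gH$ for $g\in G$, $s\in S$, where $G/H$ carries the quotient topology. Then $J(n)$ is a global $O(n)$-slice of the $GL(n)$-space $\mathcal B(n)$, and its slicing map $f_{J(n)}:\mathcal B(n)\to GL(n)/O(n)$ is continuous, open and closed. -/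

import Mathlib

open scoped Pointwise MatrixGroups

namespace Slices

/-! ### Slices and slicing maps in `G`-spaces -/

section General

variable {G X : Type*} [Group G] [MulAction G X]

/-- The `H`-hull `H(S) = {h s | h ∈ H, s ∈ S}` of a set `S` with respect to a subgroup `H`. -/
def hull (H : Subgroup G) (S : Set X) : Set X :=
  {x | ∃ h ∈ H, ∃ s ∈ S, h • s = x}

/-- The saturation `G(S)`, that is, the hull of `S` with respect to the whole group. -/
def saturation (G : Type*) {X : Type*} [Group G] [MulAction G X] (S : Set X) : Set X :=
  hull (⊤ : Subgroup G) S

theorem mem_saturation {S : Set X} {x : X} :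
    x ∈ saturation G S ↔ ∃ g : G, ∃ s ∈ S, g • s = x := by
  simp [saturation, hull]

variable [TopologicalSpace G] [TopologicalSpace X]

/-- `S` is an `H`-slice of the `G`-space `X`, where `H` is a closed subgroup of `G`.  (The continuity
of the action does not enter the definition.) -/
structure IsSlice (H : Subgroup G) (S : Set X) : Prop where
  isClosed_subgroup : IsClosed (H : Set G)
  invariant : hull H S = S
  /-- `S` is closed in its saturation `G(S)`. -/
  isClosed_in_saturation : IsClosed {x : saturation G S | (x : X) ∈ S}
  disjoint : ∀ g : G, g ∉ H → (g • S) ∩ S = ∅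
  isOpen_saturation : IsOpen (saturation G S)

/-- `S` is a global `H`-slice of the `G`-space `X`: an `H`-slice with `G(S) = X`. -/
structure IsGlobalSlice (H : Subgroup G) (S : Set X) : Prop extends IsSlice H S where
  saturation_eq : saturation G S = Set.univ

/-- The slicing map `f_S : G(S) → G/H`, `f_S (g s) = g H`, of an `H`-slice `S`.  A representation
`x = g s` is chosen; the value does not depend on it, see `IsSlice.slicingMap_eq`. -/
noncomputable def IsSlice.slicingMap {H : Subgroup G} {S : Set X} (_hS : IsSlice H S) :
    saturation G S → G ⧸ H :=
  fun x => QuotientGroup.mk (mem_saturation.mp x.2).choose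

/-- The defining rule `f_S (g s) = g H`. -/
theorem IsSlice.slicingMap_eq {H : Subgroup G} {S : Set X} (hS : IsSlice H S)
    (x : saturation G S) (g : G) (s : X) (hs : s ∈ S) (hx : g • s = x) :
    hS.slicingMap x = QuotientGroup.mk g := by
  obtain ⟨s', hs', hx'⟩ := (mem_saturation.mp x.2).choose_spec
  unfold IsSlice.slicingMap
  set g' := (mem_saturation.mp x.2).choose
  rw [QuotientGroup.eq]
  by_contra hg
  have hmem : s' ∈ ((g'⁻¹ * g) • S) ∩ S := by
    refine ⟨⟨s, hs, ?_⟩, hs'⟩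
    change (g'⁻¹ * g) • s = s'
    rw [mul_smul, hx, ← hx', inv_smul_smul]
  rw [hS.disjoint _ hg] at hmem
  exact hmem

/-- The slicing map of a global slice, as a map on the whole space `X = G(S)`. -/
noncomputable def IsGlobalSlice.slicingMap {H : Subgroup G} {S : Set X}
    (hS : IsGlobalSlice H S) : X → G ⧸ H :=
  fun x => hS.toIsSlice.slicingMap ⟨x, hS.saturation_eq ▸ Set.mem_univ x⟩

/-- The defining rule `f_S (g s) = g H`, for a global slice. -/
theorem IsGlobalSlice.slicingMap_smul {H : Subgroup G} {S : Set X} (hS : IsGlobalSlice H S)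
    (g : G) (s : X) (hs : s ∈ S) : hS.slicingMap (g • s) = QuotientGroup.mk g :=
  hS.toIsSlice.slicingMap_eq _ g s hs rfl

end General

/-! ### The orthogonal group and the `GL(n)`-space of symmetric convex bodies -/

/-- The orthogonal group `O(n)`, as a subgroup of `GL(n, ℝ)`. -/
def orthogonalSubgroup (n : ℕ) : Subgroup (GL (Fin n) ℝ) where
  carrier := {g | (g : Matrix (Fin n) (Fin n) ℝ) ∈ Matrix.orthogonalGroup (Fin n) ℝ}
  one_mem' := one_mem (Matrix.orthogonalGroup (Fin n) ℝ)
  mul_mem' {a b} ha hb :=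
    (Matrix.orthogonalGroup (Fin n) ℝ).mul_mem (Set.mem_ofPred.mp ha) (Set.mem_ofPred.mp hb)
  inv_mem' := by
    intro g hg
    have h1 := (Matrix.mem_orthogonalGroup_iff (Fin n) ℝ).mp hg
    have h2 := (Matrix.mem_orthogonalGroup_iff' (Fin n) ℝ).mp hg
    have h3 : ((g⁻¹ : GL (Fin n) ℝ) : Matrix (Fin n) (Fin n) ℝ)
        = (g : Matrix (Fin n) (Fin n) ℝ).transpose := Units.inv_eq_of_mul_eq_one_right h1
    change ((g⁻¹ : GL (Fin n) ℝ) : Matrix (Fin n) (Fin n) ℝ) ∈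
      Matrix.orthogonalGroup (Fin n) ℝ
    rw [h3, Matrix.mem_orthogonalGroup_iff, Matrix.transpose_transpose]
    exact h2

/-- The invertible linear transformation `x ↦ g x` of Euclidean space given by `g ∈ GL(n, ℝ)`. -/
noncomputable def act {n : ℕ} (g : GL (Fin n) ℝ) :
    EuclideanSpace ℝ (Fin n) →L[ℝ] EuclideanSpace ℝ (Fin n) :=
  Matrix.toEuclideanCLM (n := Fin n) (𝕜 := ℝ) (g : Matrix (Fin n) (Fin n) ℝ)

theorem act_one {n : ℕ} : act (1 : GL (Fin n) ℝ) = 1 := by simp [act]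

theorem act_mul {n : ℕ} (g h : GL (Fin n) ℝ) : act (g * h) = act g * act h := by simp [act]

theorem act_inv_apply {n : ℕ} (g : GL (Fin n) ℝ) (x : EuclideanSpace ℝ (Fin n)) :
    act g (act g⁻¹ x) = x := by
  change (act g * act g⁻¹) x = x
  rw [← act_mul, mul_inv_cancel, act_one]
  rfl

theorem continuous_act {n : ℕ} : Continuous (act (n := n)) :=
  (LinearMap.continuous_of_finiteDimensional
    (Matrix.toEuclideanCLM (n := Fin n) (𝕜 := ℝ)).toAlgEquiv.toLinearMap).comp
      Units.continuous_val

/-- `𝓑(n)`: the compact convex bodies of `ℝⁿ` (compact convex sets with nonempty interior) that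
are symmetric about the origin. -/
def SymBody (n : ℕ) : Type :=
  {A : ConvexBody (EuclideanSpace ℝ (Fin n)) //
    (interior (A : Set (EuclideanSpace ℝ (Fin n)))).Nonempty ∧ ∀ x ∈ A, -x ∈ A}

namespace SymBody

variable {n : ℕ}

/-- The underlying set of a symmetric convex body. -/
def set (A : SymBody n) : Set (EuclideanSpace ℝ (Fin n)) := A.1.carrier

theorem ext {A B : SymBody n} (h : A.set = B.set) : A = B :=
  Subtype.ext (ConvexBody.ext h)

/-- `𝓑(n)` carries the Hausdorff metric. -/
noncomputable instance : MetricSpace (SymBody n) := inferInstanceAs (MetricSpace (Subtype _))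

theorem dist_eq (A B : SymBody n) : dist A B = Metric.hausdorffDist A.set B.set := rfl

/-- The action `g A = {g a | a ∈ A}` of `GL(n)` on `𝓑(n)`. -/
noncomputable instance : SMul (GL (Fin n) ℝ) (SymBody n) where
  smul g A :=
    ⟨{ carrier := act g '' A.set
       convex' := A.1.convex'.linear_image (act g).toLinearMap
       isCompact' := A.1.isCompact'.image (act g).continuous
       nonempty' := A.1.nonempty'.image _ }, by
      constructor
      · have hopen : IsOpen (act g '' interior A.set) := by
          have : act g '' interior A.set = act g⁻¹ ⁻¹' interior A.set := by
            ext x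
            constructor
            · rintro ⟨y, hy, rfl⟩
              have := act_inv_apply g⁻¹ y
              rw [inv_inv] at this
              rwa [Set.mem_preimage, this]
            · intro hx
              exact ⟨_, hx, act_inv_apply g x⟩
          rw [this]
          exact isOpen_interior.preimage (act g⁻¹).continuous
        exact (A.2.1.image (act g)).mono
          (interior_maximal (Set.image_mono interior_subset) hopen)
      · rintro _ ⟨y, hy, rfl⟩
        exact ⟨-y, A.2.2 y hy, map_neg _ _⟩⟩

theorem set_smul (g : GL (Fin n) ℝ) (A : SymBody n) : (g • A).set = act g '' A.set := rfl

noncomputable instance : MulAction (GL (Fin n) ℝ) (SymBody n) where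
  one_smul A := ext (by rw [set_smul, act_one]; exact Set.image_id _)
  mul_smul g h A := ext (by
    rw [set_smul, set_smul, set_smul, act_mul, Set.image_image]
    rfl)

theorem exists_dist_le (A B : SymBody n) {a : EuclideanSpace ℝ (Fin n)} (ha : a ∈ A.set) :
    ∃ b ∈ B.set, dist a b ≤ dist A B := by
  obtain ⟨b, hb, h⟩ := B.1.isCompact'.exists_infDist_eq_dist B.1.nonempty' a
  exact ⟨b, hb, h ▸ Metric.infDist_le_hausdorffDist_of_mem ha
    (ConvexBody.hausdorffEDist_ne_top (K := A.1) (L := B.1))⟩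

/-- The action is continuous, so that `𝓑(n)` is a `GL(n)`-space. -/
instance : ContinuousSMul (GL (Fin n) ℝ) (SymBody n) where
  continuous_smul := by
    rw [continuous_iff_continuousAt]
    rintro ⟨g₀, A₀⟩
    obtain ⟨R, hR0, hR⟩ := A₀.1.isCompact'.isBounded.exists_pos_norm_le
    have key : ∀ p : GL (Fin n) ℝ × SymBody n, dist (p.1 • p.2) (g₀ • A₀) ≤
        ‖act p.1‖ * dist p.2 A₀ + ‖act p.1 - act g₀‖ * R := by
      rintro ⟨g, A⟩
      have est : ∀ a b : EuclideanSpace ℝ (Fin n), b ∈ A₀.set → dist a b ≤ dist A A₀ →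
          dist (act g a) (act g₀ b) ≤ ‖act g‖ * dist A A₀ + ‖act g - act g₀‖ * R := by
        intro a b hb hab
        have : act g a - act g₀ b = act g (a - b) + (act g - act g₀) b := by
          simp
        rw [dist_eq_norm, this]
        refine (norm_add_le _ _).trans (add_le_add ?_ ?_)
        · refine ((act g).le_opNorm _).trans ?_
          rw [← dist_eq_norm]
          gcongr
        · refine ((act g - act g₀).le_opNorm _).trans ?_
          gcongr
          exact hR b hb
      refine Metric.hausdorffDist_le_of_mem_dist (by positivity) ?_ ?_
      · rintro _ ⟨a, ha, rfl⟩
        obtain ⟨b, hb, h⟩ := exists_dist_le A A₀ ha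
        exact ⟨_, ⟨b, hb, rfl⟩, est a b hb h⟩
      · rintro _ ⟨b, hb, rfl⟩
        obtain ⟨a, ha, h⟩ := exists_dist_le A₀ A hb
        rw [dist_comm, dist_comm A₀] at h
        refine ⟨_, ⟨a, ha, rfl⟩, ?_⟩
        rw [dist_comm]
        exact est a b hb h
    rw [ContinuousAt, tendsto_iff_dist_tendsto_zero]
    refine squeeze_zero (fun _ => dist_nonneg) key ?_
    have hc : Continuous fun p : GL (Fin n) ℝ × SymBody n =>
        ‖act p.1‖ * dist p.2 A₀ + ‖act p.1 - act g₀‖ * R := by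
      have := (continuous_act (n := n)).comp (continuous_fst (Y := SymBody n))
      have h1 : Continuous fun p : GL (Fin n) ℝ × SymBody n => act p.1 := this
      fun_prop
    simpa using hc.tendsto (g₀, A₀)

end SymBody

/-! ### Maximal volume ellipsoids and the set `J(n)` -/

/-- An ellipsoid of `ℝⁿ`, with arbitrary centre: an image of the closed unit ball under an
invertible affine transformation. -/
def IsEllipsoid {n : ℕ} (E : Set (EuclideanSpace ℝ (Fin n))) : Prop :=
  ∃ (g : GL (Fin n) ℝ) (c : EuclideanSpace ℝ (Fin n)),
    E = (fun x => act g x + c) '' Metric.closedBall 0 1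

/-- `E` is an ellipsoid of maximal volume among the ellipsoids contained in `A`.  (For a convex
body `A` there is exactly one such `E`, the John ellipsoid of `A`.) -/
structure IsMaxVolumeEllipsoid {n : ℕ} (E A : Set (EuclideanSpace ℝ (Fin n))) : Prop where
  isEllipsoid : IsEllipsoid E
  subset : E ⊆ A
  volume_le : ∀ E', IsEllipsoid E' → E' ⊆ A →
    MeasureTheory.volume E' ≤ MeasureTheory.volume E

/-- `J(n)`: the bodies in `𝓑(n)` whose maximal volume ellipsoid is the closed unit ball. -/
def J (n : ℕ) : Set (SymBody n) :=
  {A | IsMaxVolumeEllipsoid (Metric.closedBall 0 1) A.set}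

end Slices

/-!
The proof reduces the assertion to two facts: `J(n)` is a compact global slice, and the action is
proper near each body in the sense of `exists_nhds_isCompact_of_smul_mem`.

Let `B` be the closed unit ball. Since the bodies are symmetric, only ellipsoids centred at the
origin matter, and `A ∈ J(n)` means that `B ⊆ A` and `|det T| ≤ 1` for all linear maps `T` with
`T B ⊆ A` (`mem_J_iff`).

* Every body is `g A` with `A ∈ J(n)` (`exists_smul_mem_J`): the continuous function `|det|` attains
  its maximum on the compact set of linear maps that carry `B` into a given body.
* If `A` and `g A` belong to `J(n)`, then `g` is orthogonal
  (`mem_orthogonalSubgroup_of_smul_mem_J`): `|det g| = 1`, and if `g = p u` is the polar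
  decomposition, then `g A` contains `B`, `p B`, and hence `((1 + p) / 2) B`. So
  `det ((1 + p) / 2) ≤ 1 = det p`, which forces `p = 1` by the inequality between the arithmetic and
  the geometric mean of `1` and each eigenvalue of `p`.
* `J(n)` is compact (`isCompact_J`): it is closed, its members lie between `B` and a ball of radius
  `2 ^ n`, and the bodies between two balls form a compact set by Blaschke's selection theorem.

The slicing map of any global slice is open. It is closed if the slice `S` is compact, because
projections along a compact factor are closed. It is continuous if, in addition, every point has a
neighbourhood into which only a compact set of group elements carries points of `S`: the
preimage of a closed set `C ⊆ G/H` is `D S`, where `D ⊆ G` is the closed preimage of `C`, and near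
each point only a compact part of `D` contributes to it. For `J(n)` such neighbourhoods exist,
because a body that is close to `A` lies between two fixed balls.
-/

open Set Filter Topology Metric

namespace Slices

/-! ### Slicing maps with compact slices -/

section General

variable {G X : Type*} [Group G] [MulAction G X] [TopologicalSpace G] [TopologicalSpace X]
  {H : Subgroup G} {S : Set X}

/-- The preimage of `f_S(U)` under `G → G/H` consists of the `g` that carry some point of the
slice into `U`. -/
theorem IsGlobalSlice.preimage_image_slicingMap (hS : IsGlobalSlice H S) (U : Set X) :
    (QuotientGroup.mk : G → G ⧸ H) ⁻¹' (hS.slicingMap '' U) = {g | ∃ s ∈ S, g • s ∈ U} := by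
  ext g
  constructor
  · rintro ⟨x, hxU, hx⟩
    obtain ⟨g', s, hs, rfl⟩ := mem_saturation.mp (hS.saturation_eq ▸ mem_univ x)
    rw [hS.slicingMap_smul g' s hs, eq_comm, QuotientGroup.eq] at hx
    have hmem : (g⁻¹ * g') • s ∈ S := by
      rw [← hS.invariant]
      exact ⟨_, hx, s, hs, rfl⟩
    refine ⟨_, hmem, ?_⟩
    rwa [smul_smul, mul_inv_cancel_left]
  · rintro ⟨s, hs, hU⟩
    exact ⟨_, hU, hS.slicingMap_smul g s hs⟩

/-- The preimage of a set `C ⊆ G/H` under the slicing map is swept out by the translates of the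
slice along the preimage of `C` in `G`. -/
theorem IsGlobalSlice.preimage_slicingMap (hS : IsGlobalSlice H S) (C : Set (G ⧸ H)) :
    hS.slicingMap ⁻¹' C =
      (fun p : G × X => p.1 • p.2) '' ((QuotientGroup.mk ⁻¹' C) ×ˢ S) := by
  ext x
  constructor
  · intro hx
    obtain ⟨g, s, hs, rfl⟩ := mem_saturation.mp (hS.saturation_eq ▸ mem_univ x)
    rw [mem_preimage, hS.slicingMap_smul g s hs] at hx
    exact ⟨(g, s), ⟨hx, hs⟩, rfl⟩
  · rintro ⟨⟨g, s⟩, ⟨hg, hs⟩, rfl⟩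
    rw [mem_preimage, hS.slicingMap_smul g s hs]
    exact hg

/-- The slicing map of a global slice is open, since each orbit map is continuous. -/
theorem IsGlobalSlice.isOpenMap_slicingMap [ContinuousSMul G X] (hS : IsGlobalSlice H S) :
    IsOpenMap hS.slicingMap := by
  intro U hU
  rw [← (QuotientGroup.isQuotientMap_mk H).isOpen_preimage, hS.preimage_image_slicingMap]
  have : {g : G | ∃ s ∈ S, g • s ∈ U} = ⋃ s ∈ S, (fun g : G => g • s) ⁻¹' U := by
    ext g
    simp
  rw [this]
  exact isOpen_biUnion fun s _ => hU.preimage (by fun_prop)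

/-- The slicing map of a compact global slice is closed, since projections along the slice are
closed. -/
theorem IsGlobalSlice.isClosedMap_slicingMap [ContinuousSMul G X] (hS : IsGlobalSlice H S)
    (hc : IsCompact S) : IsClosedMap hS.slicingMap := by
  intro F hF
  rw [← (QuotientGroup.isQuotientMap_mk H).isClosed_preimage, hS.preimage_image_slicingMap]
  have : CompactSpace S := isCompact_iff_compactSpace.mp hc
  have hcl : IsClosed {p : G × S | p.1 • (p.2 : X) ∈ F} :=
    hF.preimage (f := fun p : G × S => p.1 • (p.2 : X)) (by fun_prop)
  convert isClosedMap_fst_of_compactSpace _ hcl using 1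
  ext g
  simp

/-- The slicing map of a compact global slice `S` is continuous as soon as every point has a
neighbourhood into which `S` is carried only by the elements of some compact subset of `G`. -/
theorem IsGlobalSlice.continuous_slicingMap [ContinuousSMul G X] [T2Space X]
    (hS : IsGlobalSlice H S) (hc : IsCompact S)
    (hloc : ∀ x : X, ∃ V ∈ 𝓝 x, ∃ K : Set G, IsCompact K ∧ ∀ g, ∀ s ∈ S, g • s ∈ V → g ∈ K) :
    Continuous hS.slicingMap := by
  rw [continuous_iff_isClosed]
  intro C hC
  rw [hS.preimage_slicingMap]
  set D : Set G := QuotientGroup.mk ⁻¹' C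
  have hD : IsClosed D := hC.preimage QuotientGroup.continuous_mk
  refine isClosed_of_closure_subset fun x hx => ?_
  obtain ⟨V, hV, K, hK, hVK⟩ := hloc x
  -- near `x`, only the compact part `D ∩ K` of `D` contributes
  have hx' : x ∈ closure ((fun p : G × X => p.1 • p.2) '' ((D ∩ K) ×ˢ S)) := by
    rw [mem_closure_iff_nhds] at hx ⊢
    intro W hW
    obtain ⟨_, ⟨hyW, hyV⟩, ⟨⟨g, s⟩, ⟨hg, hs⟩, rfl⟩⟩ := hx _ (inter_mem hW hV)
    exact ⟨_, hyW, ⟨(g, s), ⟨⟨hg, hVK g s hs hyV⟩, hs⟩, rfl⟩⟩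
  have hcpt : IsCompact ((fun p : G × X => p.1 • p.2) '' ((D ∩ K) ×ˢ S)) :=
    ((hK.inter_left hD).prod hc).image (by fun_prop)
  rw [hcpt.isClosed.closure_eq] at hx'
  exact image_mono (prod_mono_left inter_subset_left) hx'

end General

/-! ### Positive definite matrices and polar decomposition -/

section Matrix

variable {ι : Type*} [Fintype ι] [DecidableEq ι]

/-- A positive definite `p` with `det p = 1` and `det ((1 + p) / 2) ≤ 1` is the identity: the
eigenvalues satisfy `λ ≤ ((1 + λ) / 2) ^ 2`, with equality only for `λ = 1`. -/
theorem eq_one_of_det_half_one_add_le {p : Matrix ι ι ℝ} (hp : p.PosDef) (h1 : p.det = 1)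
    (h2 : ((2⁻¹ : ℝ) • (1 + p)).det ≤ 1) : p = 1 := by
  have hH := hp.isHermitian
  have hpos := hp.eigenvalues_pos
  have hdet : ((2⁻¹ : ℝ) • (1 + p)).det = ∏ i, ((1 + hH.eigenvalues i) / 2) := by
    have h := Matrix.eval_charpoly p (-1)
    rw [hH.charpoly_eq, Polynomial.eval_prod] at h
    have e : Matrix.scalar ι (-1 : ℝ) - p = -(1 + p) := by
      rw [map_neg, map_one]
      abel
    rw [e, Matrix.det_neg] at h
    have e2 : ∏ i, Polynomial.eval (-1) (Polynomial.X - Polynomial.C (hH.eigenvalues i : ℝ)) =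
        (-1) ^ Fintype.card ι * ∏ i, (1 + hH.eigenvalues i) := by
      rw [← Finset.card_univ, ← Finset.prod_const, ← Finset.prod_mul_distrib]
      refine Finset.prod_congr rfl fun i _ => ?_
      simp
      ring
    have h' : ∏ i, (1 + hH.eigenvalues i) = (1 + p).det :=
      mul_left_cancel₀ (pow_ne_zero _ (by norm_num)) (e2.symm.trans h)
    rw [Matrix.det_smul, ← h', ← Finset.card_univ, ← Finset.prod_const,
      ← Finset.prod_mul_distrib]
    exact Finset.prod_congr rfl fun i _ => by ring
  have hev : hH.eigenvalues = fun _ => 1 := by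
    by_contra hne
    obtain ⟨i, hi⟩ := Function.ne_iff.mp hne
    have hlt : ∏ i, hH.eigenvalues i < ∏ i, ((1 + hH.eigenvalues i) / 2) ^ 2 := by
      refine Finset.prod_lt_prod (fun i _ => hpos i) (fun j _ => ?_) ⟨i, Finset.mem_univ _, ?_⟩
      · nlinarith [sq_nonneg (hH.eigenvalues j - 1)]
      · have := pow_pos (abs_pos.mpr (sub_ne_zero.mpr hi)) 2
        rw [sq_abs] at this
        nlinarith
    have hd := hH.det_eq_prod_eigenvalues
    rw [h1] at hd
    simp only [RCLike.ofReal_real_eq_id, id] at hd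
    rw [← hd, Finset.prod_pow, ← hdet] at hlt
    have h0 : 0 ≤ ((2⁻¹ : ℝ) • (1 + p)).det := by
      rw [hdet]
      exact Finset.prod_nonneg fun i _ => by linarith [hpos i]
    exact absurd hlt (not_lt.mpr (pow_le_one₀ h0 h2))
  have := hH.spectral_theorem
  rw [hev] at this
  rw [this]
  have e : Matrix.diagonal (RCLike.ofReal ∘ fun _ : ι => (1 : ℝ)) = (1 : Matrix ι ι ℝ) := by
    ext i j
    simp [Matrix.diagonal_apply, Matrix.one_apply]
  rw [e, map_one]

open scoped MatrixOrder Matrix.Norms.L2Operator in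
/-- Polar decomposition of an invertible real matrix. -/
theorem exists_posDef_mul_orthogonal {g : Matrix ι ι ℝ} (hg : IsUnit g) :
    ∃ p u : Matrix ι ι ℝ, p.PosDef ∧ u ∈ Matrix.orthogonalGroup ι ℝ ∧ g = p * u := by
  have hS : (g * g.conjTranspose).PosSemidef := Matrix.posSemidef_self_mul_conjTranspose g
  set p := CFC.sqrt (g * g.conjTranspose)
  have hp0 : p.PosSemidef := Matrix.nonneg_iff_posSemidef.mp (CFC.sqrt_nonneg _)
  have hpp : p * p = g * g.conjTranspose :=
    CFC.sqrt_mul_sqrt_self _ hS.nonneg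
  have hgdet : g.det ≠ 0 := ((Matrix.isUnit_iff_isUnit_det g).mp hg).ne_zero
  have hpdet : p.det ≠ 0 := by
    intro h0
    have := congrArg Matrix.det hpp
    rw [Matrix.det_mul, Matrix.det_mul, Matrix.det_conjTranspose, h0] at this
    simp [hgdet] at this
  have hpu : IsUnit p.det := isUnit_iff_ne_zero.mpr hpdet
  refine ⟨p, p⁻¹ * g, hp0.posDef_iff_det_ne_zero.mpr hpdet, ?_, ?_⟩
  · rw [Matrix.mem_orthogonalGroup_iff, Matrix.transpose_mul]
    have hpt : p.transpose = p := by
      have := hp0.isHermitian.eq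
      rwa [Matrix.conjTranspose_eq_transpose_of_trivial] at this
    rw [Matrix.conjTranspose_eq_transpose_of_trivial] at hpp
    rw [Matrix.transpose_nonsing_inv, hpt, Matrix.mul_assoc, ← Matrix.mul_assoc g, ← hpp,
      Matrix.mul_assoc, Matrix.mul_nonsing_inv _ hpu, Matrix.mul_one,
      Matrix.nonsing_inv_mul _ hpu]
  · rw [Matrix.mul_nonsing_inv_cancel_left _ _ hpu]

end Matrix

variable {n : ℕ}

/-! ### Linear maps of Euclidean space given by matrices -/

theorem det_toEuclideanCLM (M : Matrix (Fin n) (Fin n) ℝ) :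
    (Matrix.toEuclideanCLM (n := Fin n) (𝕜 := ℝ) M).det = M.det := by
  rw [ContinuousLinearMap.det, Matrix.coe_toEuclideanCLM_eq_toEuclideanLin]
  exact LinearMap.det_toLpLin 2 M

theorem det_act (g : GL (Fin n) ℝ) : (act g).det = (g : Matrix (Fin n) (Fin n) ℝ).det :=
  det_toEuclideanCLM _

theorem det_clm_mul (S T : EuclideanSpace ℝ (Fin n) →L[ℝ] EuclideanSpace ℝ (Fin n)) :
    (S * T).det = S.det * T.det :=
  LinearMap.det_comp _ _

theorem det_clm_smul (c : ℝ) (T : EuclideanSpace ℝ (Fin n) →L[ℝ] EuclideanSpace ℝ (Fin n)) :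
    (c • T).det = c ^ n * T.det := by
  have := LinearMap.det_smul c (T : EuclideanSpace ℝ (Fin n) →ₗ[ℝ] EuclideanSpace ℝ (Fin n))
  rwa [finrank_euclideanSpace_fin] at this

theorem det_act_inv_mul_det_act (g : GL (Fin n) ℝ) : (act g⁻¹).det * (act g).det = 1 := by
  rw [← det_clm_mul, ← act_mul, inv_mul_cancel, act_one]
  exact LinearMap.det_id

theorem act_apply_inv (g : GL (Fin n) ℝ) (x : EuclideanSpace ℝ (Fin n)) :
    act g⁻¹ (act g x) = x := by
  simpa using act_inv_apply g⁻¹ x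

theorem exists_act_eq {T : EuclideanSpace ℝ (Fin n) →L[ℝ] EuclideanSpace ℝ (Fin n)}
    (hT : T.det ≠ 0) : ∃ g : GL (Fin n) ℝ, act g = T := by
  obtain ⟨M, rfl⟩ := (Matrix.toEuclideanCLM (n := Fin n) (𝕜 := ℝ)).surjective T
  have hM : M.det ≠ 0 := det_toEuclideanCLM M ▸ hT
  exact ⟨Matrix.GeneralLinearGroup.mkOfDetNeZero M hM, rfl⟩

theorem norm_toEuclideanCLM_orthogonal {u : Matrix (Fin n) (Fin n) ℝ}
    (hu : u ∈ Matrix.orthogonalGroup (Fin n) ℝ) (x : EuclideanSpace ℝ (Fin n)) :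
    ‖Matrix.toEuclideanCLM (n := Fin n) (𝕜 := ℝ) u x‖ = ‖x‖ := by
  refine ContinuousLinearMap.norm_map_of_mem_unitary ?_ x
  rw [Unitary.mem_iff] at hu ⊢
  rw [← map_star, ← map_mul, ← map_mul, hu.1, hu.2]
  exact ⟨map_one _, map_one _⟩

theorem isClosed_orthogonalSubgroup :
    IsClosed (orthogonalSubgroup n : Set (GL (Fin n) ℝ)) := by
  have : (orthogonalSubgroup n : Set (GL (Fin n) ℝ)) =
      {g : GL (Fin n) ℝ |
        (g : Matrix (Fin n) (Fin n) ℝ) * (g : Matrix (Fin n) (Fin n) ℝ).transpose = 1} := by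
    ext g
    exact Matrix.mem_orthogonalGroup_iff (Fin n) ℝ
  rw [this]
  have hc : Continuous fun g : GL (Fin n) ℝ => (g : Matrix (Fin n) (Fin n) ℝ) :=
    Units.continuous_val
  exact isClosed_eq (by fun_prop) continuous_const

/-- Sets of `g ∈ GL(n)` with bounds on `g` and `g⁻¹` are compact. -/
theorem isCompact_setOf_norm_act_le (a b : ℝ) :
    IsCompact {g : GL (Fin n) ℝ | ‖act g‖ ≤ a ∧ ‖act g⁻¹‖ ≤ b} := by
  let φ := Matrix.toEuclideanCLM (n := Fin n) (𝕜 := ℝ)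
  have hφ : Continuous φ.symm :=
    LinearMap.continuous_of_finiteDimensional φ.symm.toAlgEquiv.toLinearMap
  have hK : IsCompact ((φ.symm '' closedBall 0 a) ×ˢ
      (MulOpposite.op '' (φ.symm '' closedBall 0 b))) :=
    ((isCompact_closedBall _ _).image hφ).prod
      (((isCompact_closedBall _ _).image hφ).image MulOpposite.continuous_op)
  refine (Units.isClosedEmbedding_embedProduct.isCompact_preimage hK).of_isClosed_subset ?_ ?_
  · have h1 : Continuous fun g : GL (Fin n) ℝ => ‖act g‖ := continuous_act.norm
    have h2 : Continuous fun g : GL (Fin n) ℝ => ‖act g⁻¹‖ :=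
      (continuous_act.comp continuous_inv).norm
    exact (isClosed_le h1 continuous_const).inter (isClosed_le h2 continuous_const)
  · rintro g ⟨h1, h2⟩
    refine ⟨⟨act g, by simpa using h1, φ.symm_apply_apply _⟩,
      ⟨_, ⟨act g⁻¹, by simpa using h2, φ.symm_apply_apply _⟩, rfl⟩⟩

/-- A linear map that carries the ball of radius `r` into the ball of radius `R` has norm at most
`R / r`. -/
theorem norm_le_of_mapsTo_closedBall
    {T : EuclideanSpace ℝ (Fin n) →L[ℝ] EuclideanSpace ℝ (Fin n)} {r R : ℝ} (hr : 0 < r)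
    (hR : 0 ≤ R) (h : ∀ x, ‖x‖ ≤ r → ‖T x‖ ≤ R) : ‖T‖ ≤ R / r := by
  refine T.opNorm_le_bound (by positivity) fun x => ?_
  rcases eq_or_ne x 0 with rfl | hx
  · simp
  have hx' : 0 < ‖x‖ := norm_pos_iff.mpr hx
  have := h ((r / ‖x‖) • x) (by
    rw [norm_smul, Real.norm_of_nonneg (by positivity), div_mul_cancel₀ _ hx'.ne'])
  rw [map_smul, norm_smul, Real.norm_of_nonneg (by positivity), div_mul_eq_mul_div,
    div_le_iff₀ hx'] at this
  rw [div_mul_eq_mul_div, le_div_iff₀ hr]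
  linarith

theorem volume_ellipsoid (g : GL (Fin n) ℝ) (c : EuclideanSpace ℝ (Fin n)) :
    MeasureTheory.volume ((fun x => act g x + c) '' closedBall 0 1) =
      ENNReal.ofReal |(act g).det| *
        MeasureTheory.volume (closedBall (0 : EuclideanSpace ℝ (Fin n)) 1) := by
  have : (fun x => act g x + c) '' closedBall 0 1 =
      (fun x => x + c) '' (act g '' closedBall 0 1) := by
    rw [image_image]
  rw [this, image_add_right, MeasureTheory.measure_preimage_add_right,
    MeasureTheory.Measure.addHaar_image_continuousLinearMap]

/-! ### Symmetric convex bodies near a given one -/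

namespace SymBody

theorem neg_mem (A : SymBody n) {x : EuclideanSpace ℝ (Fin n)} (hx : x ∈ A.set) :
    -x ∈ A.set := A.2.2 x hx

theorem convex (A : SymBody n) : Convex ℝ A.set := A.1.convex'

theorem isCompact (A : SymBody n) : IsCompact A.set := A.1.isCompact'

theorem mem_smul_iff {g : GL (Fin n) ℝ} {A : SymBody n} {x : EuclideanSpace ℝ (Fin n)} :
    x ∈ (g • A).set ↔ act g⁻¹ x ∈ A.set := by
  rw [set_smul]
  constructor
  · rintro ⟨y, hy, rfl⟩
    rwa [act_apply_inv]
  · exact fun h => ⟨_, h, act_inv_apply g x⟩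

theorem zero_mem_interior (A : SymBody n) : (0 : EuclideanSpace ℝ (Fin n)) ∈ interior A.set := by
  obtain ⟨x, hx⟩ := A.2.1
  have h := A.convex.combo_interior_self_mem_interior hx
    (A.neg_mem (interior_subset hx)) (a := 2⁻¹) (b := 2⁻¹) (by norm_num) (by norm_num)
    (by norm_num)
  simpa using h

theorem exists_closedBall_subset (A : SymBody n) :
    ∃ r : ℝ, 0 < r ∧ closedBall 0 r ⊆ A.set := by
  obtain ⟨r, hr, h⟩ := nhds_basis_closedBall.mem_iff.mp
    (mem_interior_iff_mem_nhds.mp A.zero_mem_interior)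
  exact ⟨r, hr, h⟩

/-- If `A` contains the ball of radius `r`, a body at distance at most `r - s` from `A` contains
the ball of radius `s`: otherwise a hyperplane would separate it from a point of that ball. -/
theorem closedBall_subset_of_dist_le {A B : SymBody n} {r s : ℝ} (hr : 0 ≤ r)
    (hA : closedBall 0 r ⊆ A.set) (hAB : dist A B ≤ r - s) : closedBall 0 s ⊆ B.set := by
  intro y hy
  by_contra hyB
  obtain ⟨f, a, hfa, hay⟩ :=
    geometric_hahn_banach_closed_point B.convex B.isCompact.isClosed hyB
  obtain ⟨u, rfl⟩ := (InnerProductSpace.toDual ℝ (EuclideanSpace ℝ (Fin n))).surjective f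
  simp only [InnerProductSpace.toDual_apply_apply] at hfa hay
  have hu : 0 < ‖u‖ := by
    rw [norm_pos_iff]
    rintro rfl
    have := hfa 0 (interior_subset B.zero_mem_interior)
    simp only [inner_zero_left] at this hay
    linarith
  have hz : (r / ‖u‖) • u ∈ A.set := hA (by
    rw [mem_closedBall_zero_iff, norm_smul, Real.norm_of_nonneg (by positivity),
      div_mul_cancel₀ _ hu.ne'])
  obtain ⟨b, hb, hd⟩ := exists_dist_le A B hz
  have h1 : inner ℝ u ((r / ‖u‖) • u) = r * ‖u‖ := by
    rw [inner_smul_right, real_inner_self_eq_norm_sq]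
    field_simp
  have h2 : inner ℝ u ((r / ‖u‖) • u - b) ≤ ‖u‖ * (r - s) :=
    (real_inner_le_norm _ _).trans (by
      rw [← dist_eq_norm]
      gcongr
      exact hd.trans hAB)
  have h3 : inner ℝ u y ≤ ‖u‖ * s :=
    (real_inner_le_norm _ _).trans (by
      gcongr
      simpa using hy)
  rw [inner_sub_right, h1] at h2
  have := hfa b hb
  linarith

/-- If `g` maps the unit ball into `A`, it maps each smaller concentric ball into all bodies near
`A`: this is `closedBall_subset_of_dist_le` for the bodies `g⁻¹ A` and `g⁻¹ B`. -/
theorem eventually_smul_mapsTo {A : SymBody n} {g : GL (Fin n) ℝ}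
    (h : MapsTo (act g) (closedBall 0 1) A.set) {t : ℝ} (ht : t < 1) :
    ∀ᶠ B in 𝓝 A, MapsTo (act g) (closedBall 0 t) B.set := by
  have hc : Tendsto (fun B : SymBody n => dist (g⁻¹ • A) (g⁻¹ • B)) (𝓝 A) (𝓝 0) := by
    have : Continuous fun B : SymBody n => dist (g⁻¹ • A) (g⁻¹ • B) := by fun_prop
    simpa using this.tendsto A
  filter_upwards [hc.eventually_le_const (sub_pos.mpr ht)] with B hB x hx
  have hA : closedBall 0 1 ⊆ (g⁻¹ • A).set := fun x hx => by
    rw [mem_smul_iff, inv_inv]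
    exact h hx
  have := closedBall_subset_of_dist_le zero_le_one hA hB hx
  rwa [mem_smul_iff, inv_inv] at this

theorem isClosed_setOf_subset (S : Set (EuclideanSpace ℝ (Fin n))) :
    IsClosed {A : SymBody n | S ⊆ A.set} := by
  refine isClosed_of_closure_subset fun A hA x hx => ?_
  rw [← A.isCompact.isClosed.closure_eq, Metric.mem_closure_iff]
  intro ε hε
  obtain ⟨B, hB, hd⟩ := Metric.mem_closure_iff.mp hA ε hε
  obtain ⟨a, ha, h⟩ := exists_dist_le B A (hB hx)
  exact ⟨a, ha, h.trans_lt (by rwa [dist_comm])⟩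

/-- The body `A` as a nonempty compact set. -/
def toNonemptyCompacts (A : SymBody n) :
    TopologicalSpace.NonemptyCompacts (EuclideanSpace ℝ (Fin n)) :=
  ⟨⟨A.set, A.isCompact⟩, A.1.nonempty'⟩

theorem isometry_toNonemptyCompacts : Isometry (toNonemptyCompacts (n := n)) := by
  intro A B
  exact ConvexBody.hausdorffEDist_coe (K := A.1) (L := B.1)

/-- Absolute convexity passes to limits in the Hausdorff metric. -/
theorem isClosed_setOf_absolutelyConvex :
    IsClosed {L : TopologicalSpace.NonemptyCompacts (EuclideanSpace ℝ (Fin n)) |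
      ∀ a b : ℝ, |a| + |b| ≤ 1 → ∀ x ∈ L, ∀ y ∈ L, a • x + b • y ∈ L} := by
  refine isClosed_of_closure_subset fun L hL a b hab x hx y hy => ?_
  change a • x + b • y ∈ (L : Set (EuclideanSpace ℝ (Fin n)))
  rw [← L.isCompact.isClosed.closure_eq, Metric.mem_closure_iff]
  intro ε hε
  obtain ⟨M, hM, hd⟩ := EMetric.mem_closure_iff.mp hL (ENNReal.ofReal (ε / 2)) (by simpa)
  have hd' : Metric.hausdorffEDist (L : Set (EuclideanSpace ℝ (Fin n))) M <
    ENNReal.ofReal (ε / 2) := hd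
  have near : ∀ {x} {K N : Set (EuclideanSpace ℝ (Fin n))}, x ∈ K →
      Metric.hausdorffEDist K N < ENNReal.ofReal (ε / 2) → ∃ y ∈ N, dist x y < ε / 2 := by
    intro x K N hx h
    obtain ⟨y, hy, hxy⟩ := Metric.exists_edist_lt_of_hausdorffEDist_lt hx h
    exact ⟨y, hy, by rwa [edist_lt_ofReal] at hxy⟩
  obtain ⟨x', hx', hxx⟩ := near hx hd'
  obtain ⟨y', hy', hyy⟩ := near hy hd'
  obtain ⟨z, hz, hzz⟩ := near (hM a b hab x' hx' y' hy') (by rwa [Metric.hausdorffEDist_comm])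
  refine ⟨z, hz, ?_⟩
  have h1 : dist (a • x + b • y) (a • x' + b • y') ≤ |a| * (ε / 2) + |b| * (ε / 2) := by
    refine (dist_add_add_le _ _ _ _).trans ?_
    rw [dist_smul₀, dist_smul₀, Real.norm_eq_abs, Real.norm_eq_abs]
    gcongr
  have h2 := dist_triangle (a • x + b • y) (a • x' + b • y') z
  nlinarith

/-- Blaschke selection: the bodies that lie between the unit ball and a larger ball form a compact
set. -/
theorem isCompact_setOf_between (R : ℝ) :
    IsCompact {A : SymBody n | closedBall 0 1 ⊆ A.set ∧ A.set ⊆ closedBall 0 R} := by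
  rw [isometry_toNonemptyCompacts.isEmbedding.isInducing.isCompact_iff]
  have hball : IsClosed {L : TopologicalSpace.NonemptyCompacts (EuclideanSpace ℝ (Fin n)) |
      closedBall 0 1 ⊆ (L : Set (EuclideanSpace ℝ (Fin n)))} := by
    have : {L : TopologicalSpace.NonemptyCompacts (EuclideanSpace ℝ (Fin n)) |
        closedBall 0 1 ⊆ (L : Set (EuclideanSpace ℝ (Fin n)))} = ⋂ x ∈ closedBall 0 1,
        {L : TopologicalSpace.NonemptyCompacts (EuclideanSpace ℝ (Fin n)) |
          ((L : Set (EuclideanSpace ℝ (Fin n))) ∩ {x}).Nonempty} := by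
      ext L
      simp [subset_def]
    rw [this]
    exact isClosed_biInter fun x _ =>
      TopologicalSpace.NonemptyCompacts.isClosed_inter_nonempty_of_isClosed isClosed_singleton
  have hcpt := (TopologicalSpace.NonemptyCompacts.isCompact_subsets_of_isCompact
    (isCompact_closedBall (0 : EuclideanSpace ℝ (Fin n)) R)).inter_right
    (hball.inter isClosed_setOf_absolutelyConvex)
  refine (congrArg IsCompact (Set.ext fun L => ?_)).mpr hcpt
  constructor
  · rintro ⟨A, ⟨h1, h2⟩, rfl⟩
    refine ⟨h2, h1, fun a b hab x hx y hy => ?_⟩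
    have h0 : (0 : EuclideanSpace ℝ (Fin n)) ∈ A.set := interior_subset A.zero_mem_interior
    have habs : ∀ (c : ℝ) {z}, z ∈ A.set → ∃ w ∈ A.set, c • z = |c| • w := by
      intro c z hz
      rcases abs_choice c with hc | hc
      · exact ⟨z, hz, by rw [hc]⟩
      · exact ⟨-z, A.neg_mem hz, by rw [hc, smul_neg, neg_smul, neg_neg]⟩
    obtain ⟨x', hx', ex⟩ := habs a hx
    obtain ⟨y', hy', ey⟩ := habs b hy
    change a • x + b • y ∈ A.set
    rw [ex, ey]
    have h3 := A.convex.sum_mem (t := Finset.univ) (w := ![|a|, |b|, 1 - (|a| + |b|)])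
      (z := ![x', y', 0]) (by intro i _; fin_cases i <;> simp [hab])
      (by simp [Fin.sum_univ_three]) (by intro i _; fin_cases i <;> simp [hx', hy', h0])
    simpa [Fin.sum_univ_three] using h3
  · rintro ⟨h2, h1, h⟩
    refine ⟨⟨⟨(L : Set (EuclideanSpace ℝ (Fin n))), ?_, L.isCompact, L.nonempty⟩, ?_, ?_⟩,
      ⟨h1, h2⟩, ?_⟩
    · intro x hx y hy a b ha hb hab
      exact h a b (by rw [abs_of_nonneg ha, abs_of_nonneg hb, hab]) x hx y hy
    · refine ⟨0, interior_mono h1 ?_⟩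
      exact ball_subset_interior_closedBall (mem_ball_self one_pos)
    · intro x hx
      have hneg : -x ∈ L := by simpa using h (-1) 0 (by simp) x hx x hx
      exact hneg
    · exact TopologicalSpace.NonemptyCompacts.ext rfl

end SymBody

/-! ### The set `J(n)` -/

/-- For a symmetric body only ellipsoids centred at the origin matter: if `A` contains the
ellipsoid `g B + c`, where `B` is the unit ball, it contains `g B - c` and hence the midpoints,
which form `g B`. -/
theorem mapsTo_of_ellipsoid_subset {A : SymBody n} {g : GL (Fin n) ℝ}
    {c : EuclideanSpace ℝ (Fin n)} (h : (fun x => act g x + c) '' closedBall 0 1 ⊆ A.set) :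
    MapsTo (act g) (closedBall 0 1) A.set := by
  intro x hx
  have h1 : act g x + c ∈ A.set := h ⟨x, hx, rfl⟩
  have h2 : -(act g (-x) + c) ∈ A.set := A.neg_mem (h ⟨-x, by simpa using hx, rfl⟩)
  have := A.convex h1 h2 (a := 2⁻¹) (b := 2⁻¹) (by norm_num) (by norm_num) (by norm_num)
  convert this using 1
  rw [map_neg]
  module

/-- `A` belongs to `J(n)` if and only if it contains the unit ball and every linear map that carries
the unit ball into `A` has determinant at most `1` in absolute value. -/
theorem mem_J_iff {A : SymBody n} : A ∈ J n ↔ closedBall 0 1 ⊆ A.set ∧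
    ∀ T : EuclideanSpace ℝ (Fin n) →L[ℝ] EuclideanSpace ℝ (Fin n),
      MapsTo T (closedBall 0 1) A.set → |T.det| ≤ 1 := by
  have hpos : MeasureTheory.volume (closedBall (0 : EuclideanSpace ℝ (Fin n)) 1) ≠ 0 :=
    (measure_closedBall_pos _ _ one_pos).ne'
  have hfin : MeasureTheory.volume (closedBall (0 : EuclideanSpace ℝ (Fin n)) 1) ≠ ⊤ :=
    MeasureTheory.measure_closedBall_lt_top.ne
  have key : ∀ (g : GL (Fin n) ℝ) (c : EuclideanSpace ℝ (Fin n)),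
      MeasureTheory.volume ((fun x => act g x + c) '' closedBall 0 1) ≤
        MeasureTheory.volume (closedBall (0 : EuclideanSpace ℝ (Fin n)) 1) ↔
      |(act g).det| ≤ 1 := by
    intro g c
    rw [volume_ellipsoid]
    nth_rewrite 2 [← one_mul (MeasureTheory.volume (closedBall _ _))]
    rw [ENNReal.mul_le_mul_iff_left hpos hfin, ENNReal.ofReal_le_one]
  constructor
  · rintro ⟨-, hsub, hvol⟩
    refine ⟨hsub, fun T hT => ?_⟩
    by_cases h0 : T.det = 0
    · simp [h0]
    obtain ⟨g, rfl⟩ := exists_act_eq h0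
    refine (key g 0).mp (hvol _ ⟨g, 0, rfl⟩ ?_)
    rintro _ ⟨x, hx, rfl⟩
    simpa using hT hx
  · rintro ⟨hsub, hdet⟩
    refine ⟨⟨1, 0, by simp [act_one]⟩, hsub, ?_⟩
    rintro _ ⟨g, c, rfl⟩ hE
    exact (key g c).mpr (hdet _ (mapsTo_of_ellipsoid_subset hE))

theorem mapsTo_act_mul_iff {g : GL (Fin n) ℝ} {A : SymBody n}
    {T : EuclideanSpace ℝ (Fin n) →L[ℝ] EuclideanSpace ℝ (Fin n)}
    {S : Set (EuclideanSpace ℝ (Fin n))} :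
    MapsTo T S (g • A).set ↔ MapsTo (act g⁻¹ * T) S A.set :=
  forall₂_congr fun _ _ => SymBody.mem_smul_iff

theorem smul_mem_J {g : GL (Fin n) ℝ} (hg : g ∈ orthogonalSubgroup n) {A : SymBody n}
    (hA : A ∈ J n) : g • A ∈ J n := by
  rw [mem_J_iff] at hA ⊢
  have hg' := inv_mem hg
  have hball : MapsTo (act g) (closedBall 0 1) (closedBall 0 1) := fun x hx => by
    rw [mem_closedBall_zero_iff] at hx ⊢
    exact (norm_toEuclideanCLM_orthogonal hg x).trans_le hx
  have hball' : MapsTo (act g⁻¹) (closedBall 0 1) (closedBall 0 1) := fun x hx => by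
    rw [mem_closedBall_zero_iff] at hx ⊢
    exact (norm_toEuclideanCLM_orthogonal hg' x).trans_le hx
  refine ⟨fun x hx => SymBody.mem_smul_iff.mpr (hA.1 (hball' hx)), fun T hT => ?_⟩
  have h1 := hA.2 _ (mapsTo_act_mul_iff.mp hT)
  have h2 := hA.2 _ (hball.mono_right hA.1)
  have h3 : T.det = (act g).det * (act g⁻¹ * T).det := by
    rw [det_clm_mul, ← mul_assoc, mul_comm (act g).det, det_act_inv_mul_det_act, one_mul]
  rw [h3, abs_mul]
  exact mul_le_one₀ h2 (abs_nonneg _) h1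

/-- Uniqueness of the maximal volume ellipsoid: if `A` and `g A` both belong to `J(n)`, then `g` is
orthogonal. -/
theorem mem_orthogonalSubgroup_of_smul_mem_J {g : GL (Fin n) ℝ} {A : SymBody n} (hA : A ∈ J n)
    (hgA : g • A ∈ J n) : g ∈ orthogonalSubgroup n := by
  rw [mem_J_iff] at hA hgA
  have hg : MapsTo (act g) (closedBall 0 1) (g • A).set := fun x hx => ⟨x, hA.1 hx, rfl⟩
  have hg1 : |(act g).det| ≤ 1 := hgA.2 _ hg
  have hg2 : |(act g⁻¹).det| ≤ 1 := hA.2 _ fun x hx => SymBody.mem_smul_iff.mp (hgA.1 hx)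
  have habs : |(act g).det| = 1 := by
    refine le_antisymm hg1 ?_
    have := congrArg abs (det_act_inv_mul_det_act g)
    rw [abs_mul, abs_one] at this
    nlinarith [abs_nonneg (act g).det]
  obtain ⟨p, u, hp, hu, hgpu⟩ := exists_posDef_mul_orthogonal g.isUnit
  have hpB : ∀ x ∈ closedBall (0 : EuclideanSpace ℝ (Fin n)) 1,
      Matrix.toEuclideanCLM (n := Fin n) (𝕜 := ℝ) p x ∈ (g • A).set := by
    -- the ellipsoids `p B` and `g B` coincide, as `u` preserves the unit ball `B`
    intro x hx
    have hu' : u * star u = 1 := Unitary.mul_star_self_of_mem hu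
    have hmem : star u ∈ Matrix.orthogonalGroup (Fin n) ℝ := Unitary.star_mem hu
    have e : p = (g : Matrix (Fin n) (Fin n) ℝ) * star u := by
      rw [hgpu, Matrix.mul_assoc, hu', Matrix.mul_one]
    rw [e, map_mul]
    refine hg ?_
    rw [mem_closedBall_zero_iff] at hx ⊢
    exact (norm_toEuclideanCLM_orthogonal hmem x).trans_le hx
  have hp1 : p.det = 1 := by
    have hd : |(act g).det| = |p.det| * |u.det| := by
      rw [det_act, hgpu, Matrix.det_mul, abs_mul]
    have hud : |u.det| = 1 := by
      have h := congrArg Matrix.det (Unitary.mul_star_self_of_mem hu)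
      rw [Matrix.det_mul, Matrix.star_eq_conjTranspose, Matrix.det_conjTranspose, star_trivial,
        Matrix.det_one, ← abs_mul_abs_self] at h
      nlinarith [abs_nonneg u.det]
    rw [habs, hud, mul_one, abs_of_pos hp.det_pos] at hd
    exact hd.symm
  -- the average of the two ellipsoids `B` and `p B` also lies in `g A`
  have hhalf : ((2⁻¹ : ℝ) • (1 + p)).det ≤ 1 := by
    rw [← det_toEuclideanCLM]
    refine (le_abs_self _).trans (hgA.2 _ fun x hx => ?_)
    have := (g • A).convex (hgA.1 hx) (hpB x hx) (a := 2⁻¹) (b := 2⁻¹) (by norm_num)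
      (by norm_num) (by norm_num)
    simpa [← smul_add] using this
  rw [eq_one_of_det_half_one_add_le hp hp1 hhalf, Matrix.one_mul] at hgpu
  change (g : Matrix (Fin n) (Fin n) ℝ) ∈ Matrix.orthogonalGroup (Fin n) ℝ
  rwa [hgpu]

/-- Existence of a maximal volume ellipsoid: every symmetric body is a linear image of a body in
`J(n)`. -/
theorem exists_smul_mem_J (A : SymBody n) : ∃ g : GL (Fin n) ℝ, ∃ B ∈ J n, g • B = A := by
  let K : Set (EuclideanSpace ℝ (Fin n) →L[ℝ] EuclideanSpace ℝ (Fin n)) :=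
    {T | MapsTo T (closedBall 0 1) A.set}
  have hKcl : IsClosed K := by
    have : K = ⋂ x ∈ closedBall (0 : EuclideanSpace ℝ (Fin n)) 1, (fun T => T x) ⁻¹' A.set := by
      ext T
      simp [K, MapsTo]
    rw [this]
    exact isClosed_biInter fun x _ => A.isCompact.isClosed.preimage (by fun_prop)
  obtain ⟨R, hR0, hR⟩ := A.isCompact.isBounded.exists_pos_norm_le
  have hKb : K ⊆ closedBall 0 (R / 1) := fun T hT => by
    rw [mem_closedBall_zero_iff]
    exact norm_le_of_mapsTo_closedBall one_pos hR0.le fun x hx => hR _ (hT (by simpa using hx))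
  have hK : IsCompact K := (isCompact_closedBall _ _).of_isClosed_subset hKcl hKb
  obtain ⟨r, hr, hrA⟩ := A.exists_closedBall_subset
  have hrK : r • (1 : EuclideanSpace ℝ (Fin n) →L[ℝ] EuclideanSpace ℝ (Fin n)) ∈ K := by
    intro x hx
    refine hrA ?_
    rw [mem_closedBall_zero_iff] at hx ⊢
    simpa [norm_smul, abs_of_pos hr] using mul_le_mul_of_nonneg_left hx hr.le
  obtain ⟨T, hTK, hT⟩ := hK.exists_isMaxOn ⟨_, hrK⟩
    (f := fun T => |T.det|) ContinuousLinearMap.continuous_det.abs.continuousOn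
  have hT0 : T.det ≠ 0 := by
    have h1 : |(r • (1 : EuclideanSpace ℝ (Fin n) →L[ℝ] EuclideanSpace ℝ (Fin n))).det| ≤
      |T.det| := hT hrK
    have h2 : (1 : EuclideanSpace ℝ (Fin n) →L[ℝ] EuclideanSpace ℝ (Fin n)).det = 1 :=
      LinearMap.det_id
    rw [det_clm_smul, h2, mul_one, abs_of_pos (pow_pos hr n)] at h1
    exact abs_pos.mp ((pow_pos hr n).trans_le h1)
  obtain ⟨g, rfl⟩ := exists_act_eq hT0
  refine ⟨g, g⁻¹ • A, mem_J_iff.mpr ⟨fun x hx => ?_, fun S hS => ?_⟩, smul_inv_smul g A⟩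
  · rw [SymBody.mem_smul_iff, inv_inv]
    exact hTK hx
  · rw [mapsTo_act_mul_iff, inv_inv] at hS
    have h : |(act g * S).det| ≤ |(act g).det| := hT hS
    rw [det_clm_mul, abs_mul] at h
    exact le_of_mul_le_mul_left (by simpa using h) (abs_pos.mpr hT0)

/-- A body in `J(n)` lies in the ball of radius `2 ^ n`: the body generated by the unit ball and a
distant point `x` contains the image of the unit ball under `(1 + ⟪e, ·⟫ x) / 2`, where
`e = x / ‖x‖`, a map of determinant `(1 + ‖x‖) / 2 ^ n`. -/
theorem subset_closedBall_of_mem_J {A : SymBody n} (hA : A ∈ J n) :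
    A.set ⊆ closedBall 0 (2 ^ n) := by
  rw [mem_J_iff] at hA
  intro x hx
  rw [mem_closedBall_zero_iff]
  rcases eq_or_ne x 0 with rfl | hx0
  · simp
  have hxn : ‖x‖ ≠ 0 := norm_ne_zero_iff.mpr hx0
  let f : EuclideanSpace ℝ (Fin n) →L[ℝ] ℝ := innerSL ℝ ((‖x‖⁻¹ : ℝ) • x)
  have hfx : f x = ‖x‖ := by
    simp only [f, innerSL_apply_apply, real_inner_smul_left, real_inner_self_eq_norm_sq]
    field_simp
  have hf : ∀ v ∈ closedBall (0 : EuclideanSpace ℝ (Fin n)) 1, |f v| ≤ 1 := fun v hv => by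
    refine (abs_real_inner_le_norm ((‖x‖⁻¹ : ℝ) • x) v).trans ?_
    rw [norm_smul, norm_inv, norm_norm, inv_mul_cancel₀ hxn, one_mul]
    simpa using hv
  let T : EuclideanSpace ℝ (Fin n) →L[ℝ] EuclideanSpace ℝ (Fin n) :=
    (2⁻¹ : ℝ) • (1 + f.smulRight x)
  have hTdet : T.det = (2⁻¹ : ℝ) ^ n * (1 + ‖x‖) := by
    rw [det_clm_smul, ← hfx]
    have h := LinearMap.transvection.det (f : EuclideanSpace ℝ (Fin n) →ₗ[ℝ] ℝ) x
    exact congrArg _ h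
  have hT : MapsTo T (closedBall 0 1) A.set := by
    intro v hv
    have hfv : f v • x ∈ A.set := by
      have h := abs_le.mp (hf v hv)
      have := A.convex hx (A.neg_mem hx) (a := (1 + f v) / 2) (b := (1 - f v) / 2)
        (by linarith) (by linarith) (by ring)
      convert this using 1
      module
    have := A.convex (hA.1 hv) hfv (a := 2⁻¹) (b := 2⁻¹) (by norm_num) (by norm_num)
      (by norm_num)
    simpa [T, ← smul_add] using this
  have h := (le_abs_self _).trans (hA.2 T hT)
  rw [hTdet, inv_pow, inv_mul_le_iff₀ (by positivity)] at h
  linarith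

/-- The set `J(n)` is closed: a linear map of determinant greater than `1` that carries the unit
ball into `A` can be shrunk slightly, and then carries the ball into all bodies near `A`. -/
theorem isClosed_J : IsClosed (J n) := by
  refine isClosed_of_closure_subset fun A hA => mem_J_iff.mpr ⟨?_, fun T hT => ?_⟩
  · exact closure_minimal (fun B hB => (mem_J_iff.mp hB).1)
      (SymBody.isClosed_setOf_subset (closedBall 0 1)) hA
  · by_contra! hdet
    have hT0 : T.det ≠ 0 := abs_pos.mp (one_pos.trans hdet)
    obtain ⟨g, rfl⟩ := exists_act_eq hT0
    have hlim : Tendsto (fun t : ℝ => t ^ n * |(act g).det|) (𝓝[<] 1) (𝓝 |(act g).det|) := by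
      have : Continuous fun t : ℝ => t ^ n * |(act g).det| := by fun_prop
      simpa using (this.tendsto 1).mono_left nhdsWithin_le_nhds
    obtain ⟨t, ⟨ht, ht1⟩, ht0⟩ := (((hlim.eventually_const_lt hdet).and
      self_mem_nhdsWithin).and (mem_nhdsWithin_of_mem_nhds (Ioi_mem_nhds one_pos))).exists
    obtain ⟨B, hB, hBJ⟩ := mem_closure_iff_nhds.mp hA _ (SymBody.eventually_smul_mapsTo hT ht1)
    have hB' : MapsTo (t • act g) (closedBall 0 1) B.set := fun x hx => by
      have : t • x ∈ closedBall (0 : EuclideanSpace ℝ (Fin n)) t := by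
        rw [mem_closedBall_zero_iff] at hx ⊢
        rw [norm_smul, Real.norm_of_nonneg (le_of_lt ht0)]
        exact mul_le_of_le_one_right (le_of_lt ht0) hx
      simpa using hB this
    have := (mem_J_iff.mp hBJ).2 _ hB'
    rw [det_clm_smul, abs_mul, abs_of_pos (pow_pos ht0 n)] at this
    exact absurd ht (not_lt.mpr this)

theorem isCompact_J : IsCompact (J n) :=
  (SymBody.isCompact_setOf_between (2 ^ n)).of_isClosed_subset isClosed_J fun _ hA =>
    ⟨(mem_J_iff.mp hA).1, subset_closedBall_of_mem_J hA⟩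

/-- Bodies near `A` contain a fixed ball and are contained in a fixed ball.  As bodies in `J(n)` are
pinched between the unit ball and the ball of radius `2 ^ n`, this bounds both `g` and `g⁻¹` if `g`
carries a body in `J(n)` to a body near `A`. -/
theorem exists_nhds_isCompact_of_smul_mem (A : SymBody n) :
    ∃ V ∈ 𝓝 A, ∃ K : Set (GL (Fin n) ℝ), IsCompact K ∧ ∀ g, ∀ B ∈ J n, g • B ∈ V → g ∈ K := by
  obtain ⟨r, hr, hrA⟩ := A.exists_closedBall_subset
  obtain ⟨R, hR0, hR⟩ := A.isCompact.isBounded.exists_pos_norm_le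
  refine ⟨closedBall A (r / 2), closedBall_mem_nhds A (by positivity), _,
    isCompact_setOf_norm_act_le ((R + r / 2) / 1) (2 ^ n / (r / 2)), fun g B hB hgB => ⟨?_, ?_⟩⟩
  · refine norm_le_of_mapsTo_closedBall one_pos (by positivity) fun x hx => ?_
    have hx' : act g x ∈ (g • B).set := ⟨x, (mem_J_iff.mp hB).1 (by simpa using hx), rfl⟩
    obtain ⟨a, ha, hd⟩ := SymBody.exists_dist_le (g • B) A hx'
    rw [mem_closedBall] at hgB
    have h1 := norm_le_norm_add_norm_sub a (act g x)
    rw [← dist_eq_norm, dist_comm] at h1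
    linarith [hR a ha]
  · refine norm_le_of_mapsTo_closedBall (by positivity) (by positivity) fun x hx => ?_
    rw [mem_closedBall, dist_comm] at hgB
    have hx' : x ∈ (g • B).set := SymBody.closedBall_subset_of_dist_le hr.le hrA
      (s := r / 2) (by linarith) (by simpa using hx)
    simpa using subset_closedBall_of_mem_J hB (SymBody.mem_smul_iff.mp hx')

theorem isGlobalSlice_J : IsGlobalSlice (orthogonalSubgroup n) (J n) := by
  have hsat : saturation (GL (Fin n) ℝ) (J n) = univ :=
    eq_univ_of_forall fun A => mem_saturation.mpr (exists_smul_mem_J A)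
  refine ⟨⟨isClosed_orthogonalSubgroup, ?_, isClosed_J.preimage continuous_subtype_val, ?_, ?_⟩,
    hsat⟩
  · refine Subset.antisymm ?_ fun A hA => ⟨1, one_mem _, A, hA, one_smul _ _⟩
    rintro _ ⟨g, hg, A, hA, rfl⟩
    exact smul_mem_J hg hA
  · intro g hg
    rw [eq_empty_iff_forall_notMem]
    rintro _ ⟨⟨A, hA, rfl⟩, hgA⟩
    exact hg (mem_orthogonalSubgroup_of_smul_mem_J hA hgA)
  · rw [hsat]
    exact isOpen_univ

end Slices

theorem mainTheorem8 (n : ℕ) (hn : 1 ≤ n) :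
    ∃ hJ : Slices.IsGlobalSlice (Slices.orthogonalSubgroup n) (Slices.J n),
      Continuous hJ.slicingMap ∧ IsOpenMap hJ.slicingMap ∧ IsClosedMap hJ.slicingMap :=
  ⟨Slices.isGlobalSlice_J,
    Slices.isGlobalSlice_J.continuous_slicingMap Slices.isCompact_J
      Slices.exists_nhds_isCompact_of_smul_mem,
    Slices.isGlobalSlice_J.isOpenMap_slicingMap,
    Slices.isGlobalSlice_J.isClosedMap_slicingMap Slices.isCompact_J⟩
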